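/- Let $N\ge 1$ be an integer, $\sigma_s(N)=\sum_{d\mid N}d^s$, $\sigma=\sigma_1$, and for $k\ge 1$ let $c_k(N)=\sum_{1\le u\le k,\ \gcd(u,k)=1}e^{-2\pi i uN/k}$ be the Ramanujan sum. Then $$\frac{\sigma(N)}{N}=3\sum_{n=1}^{\infty}\frac1{n^2}\sum_{d\mid n}\binom{2d}{d}^{-1}c_{n/d}(N),$$ $$\frac{\sigma_2(N)}{N^2}=\frac52\sum_{n=1}^{\infty}\frac1{n^3}\sum_{d\mid n}(-1)^{d-1}\binom{2d}{d}^{-1}c_{n/d}(N),$$ $$\frac{\sigma_3(N)}{N^3}=\frac{36}{17}\sum_{n=1}^{\infty}\frac1{n^4}\sum_{d\mid n}\binom{2d}{d}^{-1}c_{n/d}(N),$$ where all three series converge absolutely. They are the Dirichlet products, at $s=2,3,4$ respectively, of the Ramanujan series $$\frac{\sigma_{s-1}(N)}{N^{s-1}}=\zeta(s)\sum_{k=1}^{\infty}\frac{c_k(N)}{k^s}\qquad(\operatorname{Re}s>1)$$ with the central binomial series $$\zeta(2)=3\sum_{n=1}^{\infty}\binom{2n}{n}^{-1}\frac1{n^2},\qquad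 \zeta(3)=\frac52\sum_{n=1}^{\infty}(-1)^{n-1}\binom{2n}{n}^{-1}\frac1{n^3},\qquad \zeta(4)=\frac{36}{17}\sum_{n=1}^{\infty}\binom{2n}{n}^{-1}\frac1{n^4},$$ and these identities also hold, with absolutely convergent series. -/

import Mathlib

/-- The Ramanujan sum `c_k(N)`: the sum of `exp(-2πi u N / k)` over the reduced residues
`1 ≤ u ≤ k`, `gcd(u, k) = 1`. -/
noncomputable def ramanujanSum (k N : ℕ) : ℂ :=
  ∑ u ∈ (Finset.Icc 1 k).filter (fun u => Nat.gcd u k = 1),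
    Complex.exp (-(Complex.I * 2 * (Real.pi : ℂ) * (u : ℂ) * (N : ℂ) / (k : ℂ)))

/-! Möbius inversion writes `ramanujanSum k N` as the convolution of μ with k·1_{k ∣ N}. Its
Dirichlet series is therefore 1/ζ(s) times a finite sum, namely σ_{s-1}(N)/N^{s-1}
(`LSeriesHasSum_ramanujanSum`). Multiplying by an absolutely convergent series for ζ(m) cancels the
zeta factor (`hasSum_mul_ramanujanSum`), so everything reduces to the central binomial series.

For ζ(2), expand t² in powers of sin t and put t = π/6, where sin t = 1/2. For ζ(3), sum a
Wilf–Zeilberger pair. For ζ(4), a second pair gives ζ(4) = 3 ∑ 1/(C(2n,n) n⁴) - 9 ∑ H_{n-1}/(C(2n,n)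
n²) with H_n = ∑_{m ≤ n} 1/m². The last sum is π⁴/1944, by expanding t⁴ in powers of sin t at π/6,
and ζ(4) = π⁴/90 finishes. -/

open Filter Topology

/-! ### Wilf–Zeilberger summation and central binomial bounds -/

/-- Summation of a Wilf–Zeilberger pair `(F, F * R)`, where `F` decays in both variables. -/
theorem tendsto_sum_of_wz_pair {F R : ℕ → ℕ → ℝ} {C D : ℝ} (hC : 0 ≤ C)
    (hF : ∀ n k, |F n k| ≤ C / (((k : ℝ) + 1) ^ 2 * (n + 1)))
    (hR : ∀ n k, |R n k| ≤ D * (((k : ℝ) + 1) * (n + 1)))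
    (h : ∀ n k, F (n + 1) k - F n k = F n (k + 1) * R n (k + 1) - F n k * R n k) :
    Tendsto (fun M => ∑ n ∈ Finset.range M, F n 0 * R n 0) atTop (𝓝 (∑' k, F 0 k)) := by
  have hsq : Summable (fun k : ℕ => 1 / ((k : ℝ) + 1) ^ 2) := by
    simpa using (summable_nat_add_iff 1).2 (Real.summable_one_div_nat_pow.2 one_lt_two)
  have hF' : ∀ n k, |F n k| ≤ C / (n + 1) * (1 / ((k : ℝ) + 1) ^ 2) := fun n k =>
    (hF n k).trans_eq (by field_simp)
  have hsum : ∀ n, Summable (F n) := fun n =>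
    Summable.of_norm_bounded (hsq.mul_left (C / (n + 1))) (hF' n)
  have hG : ∀ n, Tendsto (fun k => F n k * R n k) atTop (𝓝 0) := by
    intro n
    have h0 : Tendsto (fun k : ℕ => C * D * (1 / ((k : ℝ) + 1))) atTop (𝓝 0) := by
      simpa using tendsto_one_div_add_atTop_nhds_zero_nat.const_mul (C * D)
    refine squeeze_zero_norm (fun k => ?_) h0
    rw [norm_mul]
    refine (mul_le_mul (hF n k) (hR n k) (abs_nonneg _) (by positivity)).trans_eq ?_
    field_simp
  -- Summing `h` over `k` telescopes on the right; since `F * R` vanishes as k → ∞, only the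
  -- boundary term at k = 0 survives.
  have hstep : ∀ n, F n 0 * R n 0 = ∑' k, F n k - ∑' k, F (n + 1) k := by
    intro n
    have h1 := ((hsum (n + 1)).sub (hsum n)).hasSum.tendsto_sum_nat
    simp only [h, Finset.sum_range_sub (fun k => F n k * R n k)] at h1
    have h2 := tendsto_nhds_unique h1 ((hG n).sub_const _)
    have h3 := (hsum (n + 1)).tsum_sub (hsum n)
    simp only [h] at h3
    linarith
  simp only [hstep, Finset.sum_range_sub' (fun n => ∑' k, F n k)]
  -- The row sums are O(1/n), so the telescoping in `n` leaves only the row n = 0.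
  suffices h0 : Tendsto (fun n => ∑' k, F n k) atTop (𝓝 0) by
    simpa using h0.const_sub (∑' k, F 0 k)
  have h1 : Tendsto (fun n : ℕ => C * (∑' k : ℕ, 1 / ((k : ℝ) + 1) ^ 2) * (1 / ((n : ℝ) + 1)))
      atTop (𝓝 0) := by
    simpa only [mul_zero] using tendsto_one_div_add_atTop_nhds_zero_nat.const_mul
      (C * (∑' k : ℕ, 1 / ((k : ℝ) + 1) ^ 2))
  refine squeeze_zero_norm (fun n => ?_) h1
  refine (tsum_of_norm_bounded (hsq.mul_left (C / (n + 1))).hasSum (hF' n)).trans_eq ?_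
  rw [tsum_mul_left]
  ring

theorem two_pow_le_centralBinom (n : ℕ) : 2 ^ n ≤ n.centralBinom := by
  induction n with
  | zero => simp
  | succ n ih =>
    have h := Nat.succ_mul_centralBinom_succ n
    refine Nat.le_of_mul_le_mul_left ?_ n.succ_pos
    rw [Nat.succ_eq_add_one, h, pow_succ]
    nlinarith

theorem succ_sq_le_two_pow (n : ℕ) : (n + 1) ^ 2 ≤ 4 * 2 ^ n := by
  induction n with
  | zero => simp
  | succ n ih =>
    rcases Nat.lt_or_ge n 2 with h | h
    · interval_cases n <;> norm_num
    · rw [pow_succ 2]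
      nlinarith

theorem factorial_two_mul_eq (n : ℕ) :
    ((2 * n).factorial : ℝ) = n.centralBinom * (n.factorial : ℝ) ^ 2 := by
  have h := Nat.choose_mul_factorial_mul_factorial (show n ≤ 2 * n by lia)
  rw [show 2 * n - n = n by lia, ← Nat.centralBinom_eq_two_mul_choose] at h
  rw [← h]
  push_cast
  ring

/-! ### The series for ζ(3) -/

theorem tendsto_sum_centralBinom_cube :
    Tendsto (fun M => ∑ n ∈ Finset.range M,
      5 / 2 * ((-1 : ℝ) ^ n * ((n + 1).centralBinom : ℝ)⁻¹ * (1 / ((n : ℝ) + 1) ^ 3))) atTop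
      (𝓝 (∑' k : ℕ, 1 / ((k : ℝ) + 1) ^ 3)) := by
  -- The row n = 0 is 1/(k+1)³, while the column k = 0 times `R` is the binomial term of index n+1.
  let F : ℕ → ℕ → ℝ := fun n k => (-1) ^ n * (n.factorial : ℝ) ^ 2 * k.factorial /
    ((2 * n + k + 1).factorial * ((n : ℝ) + k + 1) ^ 2)
  let R : ℕ → ℕ → ℝ := fun n k =>
    (((n : ℝ) + k + 1) ^ 2 + 2 * (n + k + 1) * (n + 1) + 2 * (n + 1) ^ 2) /
      (2 * (n + 1) * (2 * n + k + 2))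
  have key := tendsto_sum_of_wz_pair (F := F) (R := R) (C := 1) (D := 5) zero_le_one ?_ ?_ ?_
  · refine (key.congr fun M => Finset.sum_congr rfl fun n _ => ?_).trans
      (le_of_eq (congrArg 𝓝 (tsum_congr fun k => ?_)))
    · have h1 := factorial_two_mul_eq (n + 1)
      have h2 : ((n + 1).centralBinom : ℝ) ≠ 0 := by exact_mod_cast (n + 1).centralBinom_ne_zero
      have h3 : ((n + 1).factorial : ℝ) = (n + 1) * n.factorial := by
        push_cast [Nat.factorial_succ]; ring
      have h4 : ((2 * (n + 1)).factorial : ℝ) = (2 * n + 2) * (2 * n + 0 + 1).factorial := by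
        rw [show 2 * (n + 1) = (2 * n + 0 + 1) + 1 by ring, Nat.factorial_succ]; push_cast; ring
      have h5 : (n.factorial : ℝ) ≠ 0 := by exact_mod_cast n.factorial_ne_zero
      have h6 : ((2 * n + 0 + 1).factorial : ℝ) =
          (n + 1).centralBinom * ((n + 1) * n.factorial) ^ 2 / (2 * n + 2) := by
        rw [← h3, ← h1, h4]; field_simp
      simp only [F, R, h6, Nat.factorial_zero]
      push_cast
      field_simp
      ring
    · simp only [F, Nat.factorial_succ, mul_zero, zero_add, pow_zero, Nat.factorial_zero]
      have : (k.factorial : ℝ) ≠ 0 := by exact_mod_cast k.factorial_ne_zero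
      push_cast
      field_simp
      ring
  · intro n k
    simp only [F]
    rw [abs_div, abs_mul, abs_mul, abs_pow, abs_neg, abs_one, one_pow, one_mul,
      abs_of_nonneg (by positivity), abs_of_nonneg (by positivity), abs_of_nonneg (by positivity),
      div_le_div_iff₀ (by positivity) (by positivity), one_mul]
    -- Multinomial coefficients are integers, so n! n! k! ≤ (2n+k)!; the spare factor is n+1 ≤
    -- 2n+k+1.
    have h1 : (n.factorial : ℝ) ^ 2 * k.factorial * (n + 1) ≤ (2 * n + k + 1).factorial := by
      have ha := Nat.le_of_dvd (Nat.factorial_pos _) (Nat.factorial_mul_factorial_dvd_factorial_add n k)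
      have hb := Nat.le_of_dvd (Nat.factorial_pos _)
        (Nat.factorial_mul_factorial_dvd_factorial_add n (n + k))
      rw [show n + (n + k) = 2 * n + k by ring] at hb
      have hc : n.factorial ^ 2 * k.factorial ≤ (2 * n + k).factorial := by
        refine le_trans ?_ hb
        rw [sq, mul_assoc]
        exact Nat.mul_le_mul_left _ ha
      have hd : n.factorial ^ 2 * k.factorial * (n + 1) ≤ (2 * n + k + 1).factorial := by
        rw [Nat.factorial_succ, mul_comm (2 * n + k + 1)]
        exact Nat.mul_le_mul hc (by lia)
      exact_mod_cast hd
    have h2 : ((k : ℝ) + 1) ^ 2 ≤ ((n : ℝ) + k + 1) ^ 2 := by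
      gcongr; linarith [Nat.cast_nonneg (α := ℝ) n]
    calc (n.factorial : ℝ) ^ 2 * k.factorial * (((k : ℝ) + 1) ^ 2 * (n + 1))
        = ((n.factorial : ℝ) ^ 2 * k.factorial * (n + 1)) * ((k : ℝ) + 1) ^ 2 := by ring
      _ ≤ _ := by gcongr
  · intro n k
    simp only [R]
    rw [abs_of_nonneg (by positivity), div_le_iff₀ (by positivity)]
    have hn : (0 : ℝ) ≤ n := n.cast_nonneg
    have hk : (0 : ℝ) ≤ k := k.cast_nonneg
    have h1 : (n : ℝ) + k + 1 ≤ (n + 1) * (k + 1) := by nlinarith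
    have h2 : (n : ℝ) + 1 ≤ (n + 1) * (k + 1) := by nlinarith
    have h3 : ((n : ℝ) + 1) * (k + 1) ≤ (n + 1) * (2 * n + k + 2) := by
      gcongr <;> linarith
    calc ((n : ℝ) + k + 1) ^ 2 + 2 * (n + k + 1) * (n + 1) + 2 * (n + 1) ^ 2
        ≤ (((n : ℝ) + 1) * (k + 1)) ^ 2 + 2 * ((n + 1) * (k + 1)) * ((n + 1) * (k + 1)) +
          2 * ((n + 1) * (k + 1)) ^ 2 := by gcongr
      _ = 5 * (((k : ℝ) + 1) * (n + 1)) * ((n + 1) * (k + 1)) := by ring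
      _ ≤ 5 * (((k : ℝ) + 1) * (n + 1)) * ((n + 1) * (2 * n + k + 2)) := by gcongr
      _ ≤ 5 * (((k : ℝ) + 1) * (n + 1)) * (2 * (n + 1) * (2 * n + k + 2)) := by
        have : (0 : ℝ) ≤ (n + 1) * (2 * n + k + 2) := by positivity
        gcongr
        linarith
  · intro n k
    simp only [F, R]
    have e1 : ((n + 1).factorial : ℝ) = (n + 1) * n.factorial := by
      push_cast [Nat.factorial_succ]; ring
    have e2 : ((k + 1).factorial : ℝ) = (k + 1) * k.factorial := by
      push_cast [Nat.factorial_succ]; ring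
    have e3 : ((2 * (n + 1) + k + 1).factorial : ℝ) =
        (2 * n + k + 3) * (2 * n + k + 2) * (2 * n + k + 1).factorial := by
      rw [show 2 * (n + 1) + k + 1 = (2 * n + k + 1) + 1 + 1 by ring, Nat.factorial_succ,
        Nat.factorial_succ]
      push_cast; ring
    have e4 : ((2 * n + (k + 1) + 1).factorial : ℝ) = (2 * n + k + 2) * (2 * n + k + 1).factorial := by
      rw [show 2 * n + (k + 1) + 1 = (2 * n + k + 1) + 1 by ring, Nat.factorial_succ]
      push_cast; ring
    have h1 : ((2 * n + k + 1).factorial : ℝ) ≠ 0 := by exact_mod_cast Nat.factorial_ne_zero _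
    rw [e1, e2, e3, e4, pow_succ (-1 : ℝ)]
    push_cast
    field_simp
    ring

/-! ### The Wilf–Zeilberger pair for ζ(4) -/

/-- The partial sums of `ζ(2)`. -/
noncomputable def harmonicSq (n : ℕ) : ℝ := ∑ m ∈ Finset.range n, 1 / ((m : ℝ) + 1) ^ 2

theorem harmonicSq_succ (n : ℕ) : harmonicSq (n + 1) = harmonicSq n + 1 / ((n : ℝ) + 1) ^ 2 :=
  Finset.sum_range_succ _ _

theorem harmonicSq_nonneg (n : ℕ) : 0 ≤ harmonicSq n :=
  Finset.sum_nonneg fun _ _ => by positivity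

theorem sum_one_div_add_sq_le (k n : ℕ) :
    ∑ m ∈ Finset.range n, 1 / ((k : ℝ) + m + 1) ^ 2 ≤ (n : ℝ) := by
  refine (Finset.sum_le_card_nsmul _ _ 1 fun m _ => ?_).trans_eq (by simp)
  rw [div_le_one (by positivity)]
  have : (1 : ℝ) ≤ (k : ℝ) + m + 1 := by
    linarith [k.cast_nonneg (α := ℝ), m.cast_nonneg (α := ℝ)]
  exact one_le_pow₀ this

theorem harmonicSq_le (n : ℕ) : harmonicSq n ≤ n := by
  simpa [harmonicSq] using sum_one_div_add_sq_le 0 n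

theorem tendsto_sum_centralBinom_fourth :
    Tendsto (fun M => ∑ n ∈ Finset.range M,
      (3 * (((n + 1).centralBinom : ℝ)⁻¹ * (1 / ((n : ℝ) + 1) ^ 4)) -
        9 * (harmonicSq n * (((n + 1).centralBinom : ℝ)⁻¹ * (1 / ((n : ℝ) + 1) ^ 2))))) atTop
      (𝓝 (∑' k : ℕ, 1 / ((k : ℝ) + 1) ^ 4)) := by
  let A : ℕ → ℕ → ℝ := fun n k => (n.factorial : ℝ) ^ 4 * (k.factorial : ℝ) ^ 2 /
    ((2 * n).factorial * ((n + k + 1).factorial : ℝ) ^ 2)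
  let h : ℕ → ℕ → ℝ := fun n k => ∑ m ∈ Finset.range (n + 1), 1 / ((k : ℝ) + m + 1) ^ 2
  -- This is the x² coefficient of the deformation of `A` by ∏_{m=1}^{n} (1 - 4x²/m²) /
  -- ∏_{m=k+1}^{n+k+1} (1 - x²/m²); the certificate `R` does not depend on x.
  let F : ℕ → ℕ → ℝ := fun n k => A n k * (h n k - 4 * harmonicSq n)
  let R : ℕ → ℕ → ℝ := fun n k => (3 * n + 3 + 2 * k) / (2 * (2 * n + 1))
  -- C = 4 · 4: one factor bounds `A`, through (n+1)² ≤ 4 · 2ⁿ, the other bounds the harmonic factor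
  -- by 4(n+1).
  have key := tendsto_sum_of_wz_pair (F := F) (R := R) (C := 16) (D := 3) (by norm_num) ?_ ?_ ?_
  · refine (key.congr fun M => Finset.sum_congr rfl fun n _ => ?_).trans
      (le_of_eq (congrArg 𝓝 (tsum_congr fun k => ?_)))
    · have h1 := factorial_two_mul_eq (n + 1)
      have h2 : ((n + 1).centralBinom : ℝ) ≠ 0 := by exact_mod_cast (n + 1).centralBinom_ne_zero
      have h3 : ((n + 1).factorial : ℝ) = (n + 1) * n.factorial := by
        push_cast [Nat.factorial_succ]; ring
      have h4 : ((2 * (n + 1)).factorial : ℝ) = (2 * n + 2) * (2 * n + 1) * (2 * n).factorial := by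
        rw [show 2 * (n + 1) = 2 * n + 1 + 1 by ring, Nat.factorial_succ, Nat.factorial_succ]
        push_cast; ring
      have h5 : (n.factorial : ℝ) ≠ 0 := by exact_mod_cast n.factorial_ne_zero
      have h6 : ((2 * n).factorial : ℝ) =
          (n + 1).centralBinom * ((n + 1) * n.factorial) ^ 2 / ((2 * n + 2) * (2 * n + 1)) := by
        rw [← h3, ← h1, h4]; field_simp
      have h7 : h n 0 = harmonicSq n + 1 / ((n : ℝ) + 1) ^ 2 := by
        rw [← harmonicSq_succ]
        simp [h, harmonicSq]
      simp only [F, A, R, h7, h6, Nat.factorial_zero, add_zero, h3]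
      push_cast
      field_simp
      ring
    · have h0 : h 0 k = 1 / ((k : ℝ) + 1) ^ 2 := by simp [h]
      simp only [F, A, h0, harmonicSq, mul_zero, zero_add, Nat.factorial_zero, Nat.factorial_succ,
        Finset.range_zero, Finset.sum_empty]
      have : (k.factorial : ℝ) ≠ 0 := by exact_mod_cast k.factorial_ne_zero
      push_cast
      field_simp
      ring
  · intro n k
    have hA : A n k ≤ 4 / (((k : ℝ) + 1) ^ 2 * ((n : ℝ) + 1) ^ 2) := by
      simp only [A, factorial_two_mul_eq n]
      have h5 : (0 : ℝ) < n.factorial := by exact_mod_cast n.factorial_pos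
      have hc : (0 : ℝ) < n.centralBinom := by exact_mod_cast n.centralBinom_pos
      have h1 : (n.factorial : ℝ) * k.factorial * (k + 1) ≤ (n + k + 1).factorial := by
        have := Nat.le_of_dvd (Nat.factorial_pos _)
          (Nat.factorial_mul_factorial_dvd_factorial_add n (k + 1))
        rw [Nat.factorial_succ, ← add_assoc] at this
        calc (n.factorial : ℝ) * k.factorial * (k + 1)
            = n.factorial * (((k : ℝ) + 1) * k.factorial) := by ring
          _ ≤ _ := by exact_mod_cast this
      have h2 : ((n : ℝ) + 1) ^ 2 ≤ 4 * n.centralBinom := by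
        exact_mod_cast (succ_sq_le_two_pow n).trans
          (Nat.mul_le_mul_left 4 (two_pow_le_centralBinom n))
      rw [div_le_div_iff₀ (by positivity) (by positivity)]
      calc (n.factorial : ℝ) ^ 4 * (k.factorial : ℝ) ^ 2 * (((k : ℝ) + 1) ^ 2 * ((n : ℝ) + 1) ^ 2)
          = (n.factorial : ℝ) ^ 2 * ((n.factorial : ℝ) * k.factorial * (k + 1)) ^ 2 *
              ((n : ℝ) + 1) ^ 2 := by ring
        _ ≤ (n.factorial : ℝ) ^ 2 * ((n + k + 1).factorial : ℝ) ^ 2 * (4 * n.centralBinom) := by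
            gcongr
        _ = _ := by ring
    have hA0 : 0 ≤ A n k := by positivity
    have hE : |h n k - 4 * harmonicSq n| ≤ 4 * ((n : ℝ) + 1) := by
      have h1 : h n k ≤ n + 1 :=
        (sum_one_div_add_sq_le k (n + 1)).trans_eq (Nat.cast_succ n)
      have h2 : 0 ≤ h n k := Finset.sum_nonneg fun _ _ => by positivity
      have h3 := harmonicSq_le n
      have h4 := harmonicSq_nonneg n
      rw [abs_le]
      constructor <;> linarith
    rw [abs_mul, abs_of_nonneg hA0]
    refine (mul_le_mul hA hE (abs_nonneg _) (by positivity)).trans_eq ?_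
    field_simp
    norm_num
  · intro n k
    simp only [R]
    have hn : (0 : ℝ) ≤ n := n.cast_nonneg
    have hk : (0 : ℝ) ≤ k := k.cast_nonneg
    rw [abs_of_nonneg (by positivity), div_le_iff₀ (by positivity)]
    have : 0 ≤ (n : ℝ) * k := by positivity
    have : 0 ≤ (n : ℝ) * (n * k) := by positivity
    nlinarith
  · intro n k
    have e1 : ((n + 1).factorial : ℝ) = (n + 1) * n.factorial := by
      push_cast [Nat.factorial_succ]; ring
    have e2 : ((k + 1).factorial : ℝ) = (k + 1) * k.factorial := by
      push_cast [Nat.factorial_succ]; ring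
    have e3 : ((2 * (n + 1)).factorial : ℝ) = (2 * n + 2) * (2 * n + 1) * (2 * n).factorial := by
      rw [show 2 * (n + 1) = 2 * n + 1 + 1 by ring, Nat.factorial_succ, Nat.factorial_succ]
      push_cast; ring
    have e4 : ((n + k + 1 + 1).factorial : ℝ) = (n + k + 2) * (n + k + 1).factorial := by
      rw [Nat.factorial_succ (n + k + 1)]
      push_cast; ring
    have hAn : A (n + 1) k = A n k * (((n : ℝ) + 1) ^ 4 /
        ((2 * n + 2) * (2 * n + 1) * (n + k + 2) ^ 2)) := by
      simp only [A]
      rw [show n + 1 + k + 1 = n + k + 1 + 1 by ring, e1, e3, e4]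
      field_simp
    have hAk : A n (k + 1) = A n k * (((k : ℝ) + 1) ^ 2 / (n + k + 2) ^ 2) := by
      simp only [A]
      rw [show n + (k + 1) + 1 = n + k + 1 + 1 by ring, e2, e4]
      field_simp
    have hhn : h (n + 1) k = h n k + 1 / ((n : ℝ) + k + 2) ^ 2 := by
      simp only [h]
      rw [Finset.sum_range_succ _ (n + 1)]
      push_cast
      ring_nf
    have hhk : h n (k + 1) = h n k - 1 / ((k : ℝ) + 1) ^ 2 + 1 / ((n : ℝ) + k + 2) ^ 2 := by
      have h1 : h (n + 1) k = h n (k + 1) + 1 / ((k : ℝ) + 1) ^ 2 := by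
        simp only [h]
        rw [Finset.sum_range_succ' _ (n + 1)]
        push_cast
        simp only [add_zero]
        congr 1
        refine Finset.sum_congr rfl fun m _ => ?_
        ring_nf
      linarith
    simp only [F, R, hAn, hAk, hhn, hhk, harmonicSq_succ]
    push_cast
    -- What remains is rational in n, k and linear in the harmonic sums, which can be treated as
    -- free variables.
    generalize A n k = a
    generalize h n k = b
    generalize harmonicSq n = c
    field_simp
    ring

/-! ### Expansions of t² and t⁴ in powers of sin t -/

/-- Two applications of the mean value inequality; the interval has length at most 1, so neither
enlarges the bound. -/
theorem abs_le_of_abs_deriv2_le {f f' f'' : ℝ → ℝ} {a ε : ℝ} (ha : 0 ≤ a) (ha1 : a ≤ 1)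
    (h1 : ∀ t, HasDerivAt f (f' t) t) (h2 : ∀ t, HasDerivAt f' (f'' t) t)
    (hf0 : f 0 = 0) (hf'0 : f' 0 = 0) (hb : ∀ t ∈ Set.Icc 0 a, |f'' t| ≤ ε) :
    ∀ t ∈ Set.Icc 0 a, |f t| ≤ ε := by
  have hε : 0 ≤ ε := (abs_nonneg _).trans (hb 0 ⟨le_rfl, ha⟩)
  have base : ∀ {g g' : ℝ → ℝ}, (∀ t, HasDerivAt g (g' t) t) → g 0 = 0 →
      (∀ t ∈ Set.Icc 0 a, |g' t| ≤ ε) → ∀ t ∈ Set.Icc 0 a, |g t| ≤ ε := by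
    intro g g' hg hg0 hb t ht
    have h := (convex_Icc 0 a).norm_image_sub_le_of_norm_hasDerivWithin_le
      (fun x _ => (hg x).hasDerivWithinAt) hb (x := 0) (y := t) ⟨le_rfl, ha⟩ ht
    simp only [hg0, sub_zero, Real.norm_eq_abs, abs_of_nonneg ht.1] at h
    nlinarith [ht.1, ht.2]
  exact base h1 hf0 (base h2 hf'0 hb)

/-- The terms of the expansion of `t ^ 2` in powers of `sin t`. -/
noncomputable def sinTerm (k : ℕ) (t : ℝ) : ℝ :=
  4 ^ k / (2 * (k : ℝ) ^ 2 * k.centralBinom) * Real.sin t ^ (2 * k)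

noncomputable def sinTermDeriv (k : ℕ) (t : ℝ) : ℝ :=
  4 ^ k / (k * k.centralBinom) * (Real.sin t ^ (2 * k - 1) * Real.cos t)

noncomputable def sinRemainder (k : ℕ) (t : ℝ) : ℝ :=
  2 * 4 ^ k / k.centralBinom * Real.sin t ^ (2 * k)

theorem hasDerivAt_sinTerm (k : ℕ) (t : ℝ) :
    HasDerivAt (sinTerm (k + 1)) (sinTermDeriv (k + 1) t) t := by
  have h := ((Real.hasDerivAt_sin t).pow (2 * (k + 1))).const_mul
    (4 ^ (k + 1) / (2 * ((k + 1 : ℕ) : ℝ) ^ 2 * (k + 1).centralBinom))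
  refine h.congr_deriv ?_
  have hc : ((k + 1).centralBinom : ℝ) ≠ 0 := by exact_mod_cast (k + 1).centralBinom_ne_zero
  simp only [sinTermDeriv]
  push_cast
  field_simp

/-- This telescoping dictates the coefficients of `sinTerm`: the second derivative of a partial sum
is 2 minus a single remainder, and 2 is the second derivative of t². -/
theorem hasDerivAt_sinTermDeriv (k : ℕ) (t : ℝ) :
    HasDerivAt (sinTermDeriv (k + 1)) (sinRemainder k t - sinRemainder (k + 1) t) t := by
  have h := (((Real.hasDerivAt_sin t).pow (2 * k + 1)).mul (Real.hasDerivAt_cos t)).const_mul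
    (4 ^ (k + 1) / (((k + 1 : ℕ) : ℝ) * (k + 1).centralBinom))
  refine h.congr_deriv ?_
  have hc : ((k + 1).centralBinom : ℝ) ≠ 0 := by exact_mod_cast (k + 1).centralBinom_ne_zero
  have hc' : (k.centralBinom : ℝ) ≠ 0 := by exact_mod_cast k.centralBinom_ne_zero
  have hrec : ((k : ℝ) + 1) * (k + 1).centralBinom = 2 * (2 * k + 1) * k.centralBinom := by
    exact_mod_cast Nat.succ_mul_centralBinom_succ k
  have hrec' : ((k + 1).centralBinom : ℝ) = 2 * (2 * k + 1) * k.centralBinom / (k + 1) := by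
    rw [← hrec]; field_simp
  have hcos : Real.cos t ^ 2 = 1 - Real.sin t ^ 2 := Real.cos_sq' t
  simp only [sinRemainder, hrec', Pi.pow_apply]
  push_cast
  rw [show 2 * (k + 1) = 2 * k + 2 by ring]
  have : (2 * (k : ℝ) + 1) * Real.sin t ^ (2 * k) * Real.cos t * Real.cos t +
      Real.sin t ^ (2 * k + 1) * -Real.sin t
      = (2 * k + 1) * Real.sin t ^ (2 * k) - (2 * k + 2) * Real.sin t ^ (2 * k + 2) := by
    linear_combination (2 * (k : ℝ) + 1) * Real.sin t ^ (2 * k) * hcos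
  field_simp
  linear_combination 4 * 4 ^ k * this

/-- Here sin t ≤ 1/2, so the power of sin t cancels 4ᵏ and the central binomial coefficient supplies
the decay. -/
theorem sinRemainder_le (k : ℕ) (t : ℝ) (ht : t ∈ Set.Icc 0 (Real.pi / 6)) :
    |sinRemainder k t| ≤ 2 * (1 / 2) ^ k := by
  have h0 : 0 ≤ Real.sin t :=
    Real.sin_nonneg_of_nonneg_of_le_pi ht.1 (by linarith [ht.2, Real.pi_pos])
  have h1 : Real.sin t ≤ 1 / 2 := by
    rw [← Real.sin_pi_div_six]
    exact Real.sin_le_sin_of_le_of_le_pi_div_two (by linarith [ht.1, Real.pi_pos])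
      (by linarith [Real.pi_pos]) ht.2
  have hc : (2 : ℝ) ^ k ≤ k.centralBinom := by exact_mod_cast two_pow_le_centralBinom k
  have hc0 : (0 : ℝ) < 2 ^ k := by positivity
  have hc' : (0 : ℝ) < k.centralBinom := hc0.trans_le hc
  rw [sinRemainder, abs_of_nonneg (by positivity)]
  calc 2 * 4 ^ k / (k.centralBinom : ℝ) * Real.sin t ^ (2 * k)
      ≤ 2 * 4 ^ k / 2 ^ k * (1 / 2) ^ (2 * k) := by gcongr
    _ = 2 * (1 / 2) ^ k := by
      rw [pow_mul, mul_div_assoc, ← div_pow, mul_assoc, ← mul_pow]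
      norm_num

theorem sinTerm_zero (k : ℕ) : sinTerm (k + 1) 0 = 0 := by simp [sinTerm]

theorem sinTermDeriv_zero (k : ℕ) : sinTermDeriv (k + 1) 0 = 0 := by
  simp [sinTermDeriv, show 2 * (k + 1) - 1 ≠ 0 by lia]

theorem pi_div_six_le_one : Real.pi / 6 ≤ 1 := by linarith [Real.pi_le_four]

theorem abs_sum_sinTerm_sub_sq_le (K : ℕ) : ∀ t ∈ Set.Icc 0 (Real.pi / 6),
    |∑ k ∈ Finset.range K, sinTerm (k + 1) t - t ^ 2| ≤ 2 * (1 / 2) ^ K := by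
  refine abs_le_of_abs_deriv2_le (f' := fun t => ∑ k ∈ Finset.range K, sinTermDeriv (k + 1) t - 2 * t)
    (f'' := fun t => ∑ k ∈ Finset.range K, (sinRemainder k t - sinRemainder (k + 1) t) - 2)
    (by positivity) pi_div_six_le_one ?_ ?_ (by simp [sinTerm_zero]) (by simp [sinTermDeriv_zero]) ?_
  · intro t
    refine (HasDerivAt.fun_sum fun k _ => hasDerivAt_sinTerm k t).sub ?_
    simpa using hasDerivAt_pow 2 t
  · intro t
    refine (HasDerivAt.fun_sum fun k _ => hasDerivAt_sinTermDeriv k t).sub ?_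
    simpa using (hasDerivAt_id t).const_mul 2
  · intro t ht
    rw [Finset.sum_range_sub' (fun k => sinRemainder k t)]
    have h0 : sinRemainder 0 t = 2 := by simp [sinRemainder]
    rw [h0, show 2 - sinRemainder K t - 2 = -sinRemainder K t by ring, abs_neg]
    exact sinRemainder_le K t ht

/-- Abel summation: the increment 1/(k+1)² of `harmonicSq` turns a remainder into 4 times a term of
the expansion of t². The weighted series thus has second derivative 4t², hence limit t⁴/3. -/
theorem sum_harmonicSq_mul_sinRemainder_sub (K : ℕ) (t : ℝ) :
    ∑ k ∈ Finset.range K, harmonicSq k * (sinRemainder k t - sinRemainder (k + 1) t) =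
      4 * ∑ k ∈ Finset.range K, sinTerm (k + 1) t - harmonicSq K * sinRemainder K t := by
  induction K with
  | zero => simp [harmonicSq]
  | succ K ih =>
    have h : 4 * sinTerm (K + 1) t = 1 / ((K : ℝ) + 1) ^ 2 * sinRemainder (K + 1) t := by
      simp only [sinTerm, sinRemainder]
      push_cast
      field_simp
      norm_num
    rw [Finset.sum_range_succ, Finset.sum_range_succ, ih, mul_add, h, harmonicSq_succ]
    ring

theorem abs_sum_harmonicSq_mul_sinTerm_sub_le (K : ℕ) : ∀ t ∈ Set.Icc 0 (Real.pi / 6),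
    |∑ k ∈ Finset.range K, harmonicSq k * sinTerm (k + 1) t - t ^ 4 / 3| ≤
      (8 + 2 * (K : ℝ)) * (1 / 2) ^ K := by
  refine abs_le_of_abs_deriv2_le
    (f' := fun t => ∑ k ∈ Finset.range K, harmonicSq k * sinTermDeriv (k + 1) t - 4 / 3 * t ^ 3)
    (f'' := fun t => ∑ k ∈ Finset.range K,
      harmonicSq k * (sinRemainder k t - sinRemainder (k + 1) t) - 4 * t ^ 2)
    (by positivity) pi_div_six_le_one ?_ ?_ (by simp [sinTerm_zero]) (by simp [sinTermDeriv_zero]) ?_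
  · intro t
    refine (HasDerivAt.fun_sum fun k _ => (hasDerivAt_sinTerm k t).const_mul _).sub ?_
    refine ((hasDerivAt_pow 4 t).div_const 3).congr_deriv ?_
    norm_num
    ring
  · intro t
    refine (HasDerivAt.fun_sum fun k _ => (hasDerivAt_sinTermDeriv k t).const_mul _).sub ?_
    refine ((hasDerivAt_pow 3 t).const_mul (4 / 3)).congr_deriv ?_
    norm_num
    ring
  · intro t ht
    rw [sum_harmonicSq_mul_sinRemainder_sub, show ∀ a b : ℝ, 4 * a - b - 4 * t ^ 2 =
      4 * (a - t ^ 2) - b from fun a b => by ring]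
    refine (abs_sub _ _).trans ?_
    rw [abs_mul, abs_mul, abs_of_nonneg (harmonicSq_nonneg K), abs_of_pos (four_pos (α := ℝ))]
    have h1 := abs_sum_sinTerm_sub_sq_le K t ht
    have h2 : harmonicSq K * |sinRemainder K t| ≤ K * (2 * (1 / 2) ^ K) :=
      mul_le_mul (harmonicSq_le K) (sinRemainder_le K t ht) (abs_nonneg _) (Nat.cast_nonneg K)
    linarith

theorem sinTerm_pi_div_six (k : ℕ) : sinTerm (k + 1) (Real.pi / 6) =
    1 / 2 * (((k + 1).centralBinom : ℝ)⁻¹ * (1 / ((k : ℝ) + 1) ^ 2)) := by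
  rw [sinTerm, Real.sin_pi_div_six, pow_mul, show ((1 : ℝ) / 2) ^ 2 = 1 / 4 by norm_num, one_div_pow]
  push_cast
  field_simp

theorem pi_div_six_mem : Real.pi / 6 ∈ Set.Icc 0 (Real.pi / 6) := ⟨by positivity, le_rfl⟩

theorem tendsto_sum_centralBinom_sq :
    Tendsto (fun K => ∑ k ∈ Finset.range K,
      ((k + 1).centralBinom : ℝ)⁻¹ * (1 / ((k : ℝ) + 1) ^ 2)) atTop (𝓝 (Real.pi ^ 2 / 18)) := by
  have h0 : Tendsto (fun K : ℕ => 2 * (1 / 2 : ℝ) ^ K) atTop (𝓝 0) := by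
    simpa using (tendsto_pow_atTop_nhds_zero_of_lt_one (r := (1 / 2 : ℝ)) (by norm_num)
      (by norm_num)).const_mul 2
  have hz : Tendsto (fun K => ∑ k ∈ Finset.range K, sinTerm (k + 1) (Real.pi / 6) - (Real.pi / 6) ^ 2)
      atTop (𝓝 0) := squeeze_zero_norm
    (fun K => abs_sum_sinTerm_sub_sq_le K _ pi_div_six_mem) h0
  have h := tendsto_sub_nhds_zero_iff.1 hz
  simp only [sinTerm_pi_div_six, ← Finset.mul_sum] at h
  convert! h.const_mul 2 using 2 <;> ring

theorem tendsto_sum_harmonicSq_mul_centralBinom_sq :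
    Tendsto (fun K => ∑ k ∈ Finset.range K,
      harmonicSq k * (((k + 1).centralBinom : ℝ)⁻¹ * (1 / ((k : ℝ) + 1) ^ 2))) atTop
      (𝓝 (Real.pi ^ 4 / 1944)) := by
  have h0 : Tendsto (fun K : ℕ => (8 + 2 * K) * (1 / 2 : ℝ) ^ K) atTop (𝓝 0) := by
    have h1 := (tendsto_pow_atTop_nhds_zero_of_lt_one (r := (1 / 2 : ℝ)) (by norm_num)
      (by norm_num)).const_mul 8
    have h2 := (tendsto_self_mul_const_pow_of_lt_one (r := (1 / 2 : ℝ)) (by norm_num)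
      (by norm_num)).const_mul 2
    convert! h1.add h2 using 2 <;> ring
  have hz : Tendsto (fun K => ∑ k ∈ Finset.range K, harmonicSq k * sinTerm (k + 1) (Real.pi / 6) - (Real.pi / 6) ^ 4 / 3)
      atTop (𝓝 0) := squeeze_zero_norm
    (fun K => abs_sum_harmonicSq_mul_sinTerm_sub_le K _ pi_div_six_mem) h0
  have h := tendsto_sub_nhds_zero_iff.1 hz
  simp only [sinTerm_pi_div_six, mul_left_comm _ (1 / 2 : ℝ), ← Finset.mul_sum] at h
  convert! h.const_mul 2 using 2 <;> ring

/-! ### Ramanujan sums and their Dirichlet series -/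

/-- The full exponential sum modulo `k` detects divisibility by `k`. -/
theorem sum_exp_div_eq_ite (k N : ℕ) (hk : k ≠ 0) :
    ∑ u ∈ Finset.Icc 1 k,
        Complex.exp (-(Complex.I * 2 * (Real.pi : ℂ) * (u : ℂ) * (N : ℂ) / (k : ℂ))) =
      if k ∣ N then (k : ℂ) else 0 := by
  have hζ := Complex.isPrimitiveRoot_exp k hk
  set ζ := Complex.exp (2 * Real.pi * Complex.I / k) with hζdef
  have hexp : ∀ u : ℕ, Complex.exp (-(Complex.I * 2 * (Real.pi : ℂ) * (u : ℂ) * (N : ℂ) / (k : ℂ)))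
      = ((ζ ^ N)⁻¹) ^ u := by
    intro u
    rw [hζdef, ← Complex.exp_nat_mul, ← Complex.exp_neg, ← Complex.exp_nat_mul]
    congr 1
    ring
  have hpow : ((ζ ^ N)⁻¹) ^ k = 1 := by
    rw [inv_pow, ← pow_mul, mul_comm, pow_mul, hζ.pow_eq_one, one_pow, inv_one]
  have hone : (ζ ^ N)⁻¹ = 1 ↔ k ∣ N := by
    rw [inv_eq_one, hζ.pow_eq_one_iff_dvd]
  simp only [hexp]
  split_ifs with h
  · simp [hone.2 h]
  · have hne : (ζ ^ N)⁻¹ ≠ 1 := fun h' => h (hone.1 h')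
    have : ∑ u ∈ Finset.Icc 1 k, ((ζ ^ N)⁻¹) ^ u
        = (ζ ^ N)⁻¹ * ∑ u ∈ Finset.range k, ((ζ ^ N)⁻¹) ^ u := by
      rw [Finset.range_eq_Ico, Finset.mul_sum, ← Finset.Ico_add_one_right_eq_Icc,
        Finset.sum_Ico_eq_sum_range, Finset.sum_Ico_eq_sum_range]
      refine Finset.sum_congr rfl fun i _ => ?_
      ring
    rw [this, geom_sum_eq hne, hpow]
    simp

/-- Sort the residues u modulo k by d = gcd(u, k): writing u = dq makes q a reduced residue modulo
k/d with the same exponential. -/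
theorem sum_divisors_ramanujanSum (k N : ℕ) (hk : k ≠ 0) :
    ∑ d ∈ k.divisors, ramanujanSum d N = if k ∣ N then (k : ℂ) else 0 := by
  rw [← sum_exp_div_eq_ite k N hk, ← Nat.sum_div_divisors k (fun d => ramanujanSum d N),
    ← Finset.sum_fiberwise_of_maps_to (s := Finset.Icc 1 k) (t := k.divisors)
      (g := fun u => Nat.gcd u k)
      (fun u _ => Nat.mem_divisors.2 ⟨Nat.gcd_dvd_right u k, hk⟩)]
  refine Finset.sum_congr rfl fun d hd => ?_
  obtain ⟨m, rfl⟩ := Nat.dvd_of_mem_divisors hd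
  have hd0 : 0 < d := Nat.pos_of_ne_zero (left_ne_zero_of_mul hk)
  have hm0 : m ≠ 0 := right_ne_zero_of_mul hk
  rw [Nat.mul_div_cancel_left m hd0, ramanujanSum]
  refine Finset.sum_bij (fun u _ => d * u) ?_ ?_ ?_ ?_
  · intro u hu
    simp only [Finset.mem_filter, Finset.mem_Icc] at hu ⊢
    refine ⟨⟨Nat.mul_pos hd0 hu.1.1, Nat.mul_le_mul_left d hu.1.2⟩, ?_⟩
    rw [Nat.gcd_mul_left, hu.2, mul_one]
  · intro a _ b _ h
    exact Nat.eq_of_mul_eq_mul_left hd0 h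
  · intro b hb
    simp only [Finset.mem_filter, Finset.mem_Icc] at hb
    obtain ⟨q, rfl⟩ : d ∣ b := hb.2 ▸ Nat.gcd_dvd_left b (d * m)
    refine ⟨q, ?_, rfl⟩
    simp only [Finset.mem_filter, Finset.mem_Icc]
    refine ⟨⟨Nat.pos_of_mul_pos_left hb.1.1, Nat.le_of_mul_le_mul_left hb.1.2 hd0⟩, ?_⟩
    have := hb.2
    rw [Nat.gcd_mul_left] at this
    exact Nat.eq_of_mul_eq_mul_left hd0 (by rw [this, mul_one])
  · intro u _
    have h1 : (d : ℂ) ≠ 0 := by exact_mod_cast hd0.ne'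
    have h2 : (m : ℂ) ≠ 0 := by exact_mod_cast hm0
    congr 2
    push_cast
    field_simp

theorem ramanujanSum_eq_sum_moebius (k N : ℕ) (hk : 0 < k) :
    ramanujanSum k N = ∑ x ∈ k.divisorsAntidiagonal,
      (ArithmeticFunction.moebius x.1 : ℂ) * (if x.2 ∣ N then (x.2 : ℂ) else 0) :=
  ((ArithmeticFunction.sum_eq_iff_sum_mul_moebius_eq
    (f := fun k => ramanujanSum k N) (g := fun k => if k ∣ N then (k : ℂ) else 0)).1
    (fun n hn => sum_divisors_ramanujanSum n N hn.ne') k hk).symm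

/-- The Ramanujan series, as an L-series. -/
theorem LSeriesHasSum_ramanujanSum (N : ℕ) (hN : N ≠ 0) {s : ℂ} (hs : 1 < s.re) :
    LSeriesHasSum (fun k => ramanujanSum k N) s
      ((riemannZeta s)⁻¹ * ((∑ d ∈ N.divisors, (d : ℂ) ^ (s - 1)) / (N : ℂ) ^ (s - 1))) := by
  have hμ : LSeriesHasSum (fun n => (ArithmeticFunction.moebius n : ℂ)) s (riemannZeta s)⁻¹ := by
    have h := (ArithmeticFunction.LSeriesSummable_moebius_iff.2 hs).LSeriesHasSum
    have h2 := ArithmeticFunction.LSeries_zeta_mul_Lseries_moebius hs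
    rw [ArithmeticFunction.LSeries_zeta_eq_riemannZeta hs] at h2
    rwa [eq_inv_of_mul_eq_one_right h2] at h
  have hf : LSeriesHasSum (fun k => if k ∣ N then (k : ℂ) else 0) s
      ((∑ d ∈ N.divisors, (d : ℂ) ^ (s - 1)) / (N : ℂ) ^ (s - 1)) := by
    have h := hasSum_sum_of_ne_finset_zero (L := .unconditional ℕ) (s := N.divisors)
      (f := LSeries.term (fun k => if k ∣ N then (k : ℂ) else 0) s) (by
        intro b hb
        rcases eq_or_ne b 0 with rfl | hb0
        · simp
        · rw [LSeries.term_of_ne_zero hb0, if_neg (fun h => hb (Nat.mem_divisors.2 ⟨h, hN⟩)),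
            zero_div])
    refine (congrArg (HasSum _) ?_).mpr h
    -- Replacing d by N/d turns ∑ d^{1-s} into the normalised divisor sum.
    rw [← Nat.sum_div_divisors (α := ℂ) N (fun d => (d : ℂ) ^ (s - 1)), Finset.sum_div]
    refine Finset.sum_congr rfl fun d hd => ?_
    obtain ⟨e, rfl⟩ := Nat.dvd_of_mem_divisors hd
    have hd0 : d ≠ 0 := left_ne_zero_of_mul hN
    have he0 : e ≠ 0 := right_ne_zero_of_mul hN
    have hdC : (d : ℂ) ≠ 0 := by exact_mod_cast hd0
    have heC : (e : ℂ) ≠ 0 := by exact_mod_cast he0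
    rw [LSeries.term_of_ne_zero hd0, if_pos (Dvd.intro e rfl),
      Nat.mul_div_cancel_left e (Nat.pos_of_ne_zero hd0), Nat.cast_mul,
      Complex.natCast_mul_natCast_cpow, Complex.cpow_sub _ _ hdC, Complex.cpow_one]
    have h1 : (d : ℂ) ^ s ≠ 0 := by simp [Complex.cpow_eq_zero_iff, hdC]
    have h2 : (e : ℂ) ^ (s - 1) ≠ 0 := by simp [Complex.cpow_eq_zero_iff, heC]
    field_simp
  refine (LSeriesHasSum_congr s _ ?_).1 (hμ.convolution hf)
  intro n hn
  rw [LSeries.convolution_def]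
  exact (ramanujanSum_eq_sum_moebius n N (Nat.pos_of_ne_zero hn)).symm

theorem LSeriesHasSum_iff_hasSum_pnat {f : ℕ → ℂ} {s A : ℂ} :
    LSeriesHasSum f s A ↔ HasSum (fun n : ℕ+ => f n / (n : ℂ) ^ s) A := by
  rw [LSeriesHasSum, ← PNat.coe_injective.hasSum_iff]
  · refine iff_of_eq (congrArg (fun g => HasSum g A) (funext fun n => ?_))
    exact LSeries.term_of_ne_zero n.ne_zero f s
  · intro n hn
    rcases Nat.eq_zero_or_pos n with rfl | h
    · simp
    · exact absurd ⟨⟨n, h⟩, rfl⟩ hn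

theorem LSeriesHasSum_natCast_iff_hasSum_pnat {f : ℕ → ℂ} {m : ℕ} {A : ℂ} :
    LSeriesHasSum f m A ↔ HasSum (fun n : ℕ+ => 1 / (n : ℂ) ^ m * f n) A := by
  rw [LSeriesHasSum_iff_hasSum_pnat]
  refine iff_of_eq (congrArg (fun g => HasSum g A) (funext fun n => ?_))
  rw [Complex.cpow_natCast]
  ring

/-- The Dirichlet product of the Ramanujan series with a series for `ζ(m)`. -/
theorem hasSum_mul_ramanujanSum (N : ℕ) (hN : N ≠ 0) {m : ℕ} (hm : 1 < m) {a : ℕ → ℂ} {c : ℂ}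
    (ha : HasSum (fun n : ℕ+ => a n * (1 / (n : ℂ) ^ m)) (riemannZeta m / c)) :
    HasSum (fun n : ℕ+ => 1 / (n : ℂ) ^ m *
      ∑ d ∈ (n : ℕ).divisors, a d * ramanujanSum ((n : ℕ) / d) N)
      ((ArithmeticFunction.sigma (m - 1) N : ℂ) / (N : ℂ) ^ (m - 1) / c) := by
  have hs : 1 < (m : ℂ).re := by simpa using hm
  have ha' : LSeriesHasSum a m (riemannZeta m / c) := by
    rw [LSeriesHasSum_natCast_iff_hasSum_pnat]
    simpa only [mul_comm] using ha
  -- `LSeriesHasSum` is unconditional summation, so the product of the two series may be regrouped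
  -- by n = d · (n/d).
  have h := ha'.convolution (LSeriesHasSum_ramanujanSum N hN hs)
  rw [LSeriesHasSum_natCast_iff_hasSum_pnat] at h
  have hz := riemannZeta_ne_zero_of_one_lt_re hs
  have hexp : (m : ℂ) - 1 = ((m - 1 : ℕ) : ℂ) := by
    rw [Nat.cast_sub hm.le, Nat.cast_one]
  convert! h using 1
  · funext n
    rw [LSeries.convolution_def]
    exact congrArg _ (Nat.sum_divisorsAntidiagonal fun x y => a x * ramanujanSum y N).symm
  · rw [ArithmeticFunction.sigma_apply, hexp]
    simp only [Complex.cpow_natCast]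
    push_cast
    field_simp

/-! ### Central binomial series as unconditional sums -/

theorem hasSum_pnat_of_hasSum_succ {f : ℕ → ℝ} {g : ℕ+ → ℂ} {A : ℝ} (h : HasSum f A)
    (hg : ∀ k : ℕ, g k.succPNat = (f k : ℂ)) : HasSum g (A : ℂ) := by
  rw [← Equiv.pnatEquivNat.symm.hasSum_iff]
  exact (Complex.hasSum_ofReal.2 h).congr_fun hg

/-- Geometric domination; it upgrades the limits of partial sums found above to unconditional sums.
-/
theorem summable_inv_centralBinom (e : ℕ → ℝ) (he : ∀ k, |e k| ≤ 1) (m : ℕ) :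
    Summable (fun k : ℕ => e k * ((k + 1).centralBinom : ℝ)⁻¹ * (1 / ((k : ℝ) + 1) ^ m)) := by
  refine Summable.of_norm_bounded
    (summable_geometric_of_lt_one (r := (1 / 2 : ℝ)) (by norm_num) (by norm_num)) fun k => ?_
  have h1 : (2 : ℝ) ^ k ≤ (k + 1).centralBinom := by
    exact_mod_cast (Nat.pow_le_pow_right two_pos k.le_succ).trans (two_pow_le_centralBinom (k + 1))
  have h2 : 1 / ((k : ℝ) + 1) ^ m ≤ 1 := by
    rw [div_le_one (by positivity)]
    exact one_le_pow₀ (by linarith [k.cast_nonneg (α := ℝ)])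
  have h3 : ((k + 1).centralBinom : ℝ)⁻¹ ≤ ((2 : ℝ) ^ k)⁻¹ := by gcongr
  rw [norm_mul, norm_mul, Real.norm_eq_abs, Real.norm_eq_abs, Real.norm_eq_abs,
    abs_of_nonneg (by positivity : (0 : ℝ) ≤ ((k + 1).centralBinom : ℝ)⁻¹),
    abs_of_nonneg (by positivity : (0 : ℝ) ≤ 1 / ((k : ℝ) + 1) ^ m)]
  calc |e k| * ((k + 1).centralBinom : ℝ)⁻¹ * (1 / ((k : ℝ) + 1) ^ m)
      ≤ 1 * ((2 : ℝ) ^ k)⁻¹ * 1 := by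
        gcongr
        exact he k
    _ = (1 / 2) ^ k := by rw [one_div_pow]; ring

theorem hasSum_inv_centralBinom_sq :
    HasSum (fun k : ℕ => ((k + 1).centralBinom : ℝ)⁻¹ * (1 / ((k : ℝ) + 1) ^ 2))
      (Real.pi ^ 2 / 18) := by
  have hs := summable_inv_centralBinom (fun _ => 1) (by simp) 2
  simp only [one_mul] at hs
  exact hs.hasSum_iff_tendsto_nat.2 tendsto_sum_centralBinom_sq

theorem hasSum_inv_centralBinom_cube :
    HasSum (fun k : ℕ => (-1) ^ k * ((k + 1).centralBinom : ℝ)⁻¹ * (1 / ((k : ℝ) + 1) ^ 3))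
      ((∑' k : ℕ, 1 / ((k : ℝ) + 1) ^ 3) / (5 / 2)) := by
  have hs := summable_inv_centralBinom (fun k => (-1) ^ k) (by simp) 3
  refine hs.hasSum_iff_tendsto_nat.2 ?_
  have h := tendsto_sum_centralBinom_cube.div_const (5 / 2)
  simp only [← Finset.mul_sum] at h
  simpa using h

theorem hasSum_inv_centralBinom_fourth :
    HasSum (fun k : ℕ => ((k + 1).centralBinom : ℝ)⁻¹ * (1 / ((k : ℝ) + 1) ^ 4))
      (17 * Real.pi ^ 4 / 3240) := by
  have hs := summable_inv_centralBinom (fun _ => 1) (by simp) 4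
  simp only [one_mul] at hs
  refine hs.hasSum_iff_tendsto_nat.2 ?_
  have hz : ∑' k : ℕ, 1 / ((k : ℝ) + 1) ^ 4 = Real.pi ^ 4 / 90 := by
    -- The dropped term of index 0 is 1/0⁴, which is 0 by convention.
    have h := (hasSum_nat_add_iff' 1).2 hasSum_zeta_four
    simpa using h.tsum_eq
  have h := (tendsto_sum_centralBinom_fourth.add
    (tendsto_sum_harmonicSq_mul_centralBinom_sq.const_mul 9)).div_const 3
  rw [hz] at h
  convert! h using 2
  · rw [Finset.sum_sub_distrib, ← Finset.mul_sum, ← Finset.mul_sum]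
    ring
  · ring

theorem hasSum_pnat_inv_choose_sq :
    HasSum (fun n : ℕ+ => ((Nat.choose (2 * (n : ℕ)) (n : ℕ) : ℂ))⁻¹ * (1 / (n : ℂ) ^ 2))
      (riemannZeta (2 : ℕ) / 3) := by
  have h := hasSum_pnat_of_hasSum_succ
    (g := fun n : ℕ+ => ((Nat.choose (2 * (n : ℕ)) (n : ℕ) : ℂ))⁻¹ * (1 / (n : ℂ) ^ 2))
    hasSum_inv_centralBinom_sq
    (fun k => by simp [Nat.centralBinom_eq_two_mul_choose])
  convert! h using 1
  rw [Nat.cast_ofNat, riemannZeta_two]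
  push_cast
  ring

theorem hasSum_pnat_inv_choose_cube :
    HasSum (fun n : ℕ+ => (-1 : ℂ) ^ ((n : ℕ) - 1) *
      ((Nat.choose (2 * (n : ℕ)) (n : ℕ) : ℂ))⁻¹ * (1 / (n : ℂ) ^ 3))
      (riemannZeta (3 : ℕ) / (5 / 2)) := by
  have h := hasSum_pnat_of_hasSum_succ
    (g := fun n : ℕ+ => (-1 : ℂ) ^ ((n : ℕ) - 1) *
      ((Nat.choose (2 * (n : ℕ)) (n : ℕ) : ℂ))⁻¹ * (1 / (n : ℂ) ^ 3))
    hasSum_inv_centralBinom_cube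
    (fun k => by simp [Nat.centralBinom_eq_two_mul_choose])
  convert! h using 1
  rw [zeta_eq_tsum_one_div_nat_add_one_cpow (by simp)]
  simp only [Complex.cpow_natCast]
  push_cast
  rfl

theorem hasSum_pnat_inv_choose_fourth :
    HasSum (fun n : ℕ+ => ((Nat.choose (2 * (n : ℕ)) (n : ℕ) : ℂ))⁻¹ * (1 / (n : ℂ) ^ 4))
      (riemannZeta (4 : ℕ) / (36 / 17)) := by
  have h := hasSum_pnat_of_hasSum_succ
    (g := fun n : ℕ+ => ((Nat.choose (2 * (n : ℕ)) (n : ℕ) : ℂ))⁻¹ * (1 / (n : ℂ) ^ 4))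
    hasSum_inv_centralBinom_fourth
    (fun k => by simp [Nat.centralBinom_eq_two_mul_choose])
  convert! h using 1
  rw [Nat.cast_ofNat, riemannZeta_four]
  push_cast
  ring

/-! ### Assembly -/

/-- In ℂ, `Summable` is equivalent to absolute convergence, so the first component carries that
claim. -/
theorem HasSum.summable_and_eq_mul_tsum {f : ℕ+ → ℂ} {x c : ℂ} (hc : c ≠ 0)
    (h : HasSum f (x / c)) : Summable f ∧ x = c * ∑' n, f n :=
  ⟨h.summable, by rw [h.tsum_eq]; field_simp⟩

theorem theorem1 (N : ℕ) (hN : 1 ≤ N) :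
    -- the three expansions, with convergence
    ((Summable (fun n : ℕ+ => 1 / (n : ℂ) ^ 2 *
          ∑ d ∈ (n : ℕ).divisors, ((Nat.choose (2 * d) d : ℂ))⁻¹ * ramanujanSum ((n : ℕ) / d) N) ∧
        (ArithmeticFunction.sigma 1 N : ℂ) / (N : ℂ) =
          3 * ∑' n : ℕ+, 1 / (n : ℂ) ^ 2 *
            ∑ d ∈ (n : ℕ).divisors,
              ((Nat.choose (2 * d) d : ℂ))⁻¹ * ramanujanSum ((n : ℕ) / d) N) ∧
      (Summable (fun n : ℕ+ => 1 / (n : ℂ) ^ 3 *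
          ∑ d ∈ (n : ℕ).divisors,
            (-1 : ℂ) ^ (d - 1) * ((Nat.choose (2 * d) d : ℂ))⁻¹ * ramanujanSum ((n : ℕ) / d) N) ∧
        (ArithmeticFunction.sigma 2 N : ℂ) / (N : ℂ) ^ 2 =
          (5 / 2 : ℂ) * ∑' n : ℕ+, 1 / (n : ℂ) ^ 3 *
            ∑ d ∈ (n : ℕ).divisors,
              (-1 : ℂ) ^ (d - 1) * ((Nat.choose (2 * d) d : ℂ))⁻¹ *
                ramanujanSum ((n : ℕ) / d) N) ∧
      (Summable (fun n : ℕ+ => 1 / (n : ℂ) ^ 4 *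
          ∑ d ∈ (n : ℕ).divisors, ((Nat.choose (2 * d) d : ℂ))⁻¹ * ramanujanSum ((n : ℕ) / d) N) ∧
        (ArithmeticFunction.sigma 3 N : ℂ) / (N : ℂ) ^ 3 =
          (36 / 17 : ℂ) * ∑' n : ℕ+, 1 / (n : ℂ) ^ 4 *
            ∑ d ∈ (n : ℕ).divisors,
              ((Nat.choose (2 * d) d : ℂ))⁻¹ * ramanujanSum ((n : ℕ) / d) N)) ∧
    -- the Ramanujan series
    (∀ s : ℂ, 1 < s.re →
      Summable (fun k : ℕ+ => ramanujanSum (k : ℕ) N / (k : ℂ) ^ s) ∧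
      (∑ d ∈ N.divisors, (d : ℂ) ^ (s - 1)) / (N : ℂ) ^ (s - 1) =
        riemannZeta s * ∑' k : ℕ+, ramanujanSum (k : ℕ) N / (k : ℂ) ^ s) ∧
    -- the central binomial series for the zeta values
    ((Summable (fun n : ℕ+ => ((Nat.choose (2 * (n : ℕ)) (n : ℕ) : ℂ))⁻¹ * (1 / (n : ℂ) ^ 2)) ∧
        riemannZeta 2 =
          3 * ∑' n : ℕ+, ((Nat.choose (2 * (n : ℕ)) (n : ℕ) : ℂ))⁻¹ * (1 / (n : ℂ) ^ 2)) ∧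
      (Summable (fun n : ℕ+ => (-1 : ℂ) ^ ((n : ℕ) - 1) *
          ((Nat.choose (2 * (n : ℕ)) (n : ℕ) : ℂ))⁻¹ * (1 / (n : ℂ) ^ 3)) ∧
        riemannZeta 3 =
          (5 / 2 : ℂ) * ∑' n : ℕ+, (-1 : ℂ) ^ ((n : ℕ) - 1) *
            ((Nat.choose (2 * (n : ℕ)) (n : ℕ) : ℂ))⁻¹ * (1 / (n : ℂ) ^ 3)) ∧
      (Summable (fun n : ℕ+ => ((Nat.choose (2 * (n : ℕ)) (n : ℕ) : ℂ))⁻¹ * (1 / (n : ℂ) ^ 4)) ∧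
        riemannZeta 4 =
          (36 / 17 : ℂ) *
            ∑' n : ℕ+, ((Nat.choose (2 * (n : ℕ)) (n : ℕ) : ℂ))⁻¹ * (1 / (n : ℂ) ^ 4))) := by
  have hN0 : N ≠ 0 := Nat.one_le_iff_ne_zero.1 hN
  refine ⟨⟨?_, ?_, ?_⟩, fun s hs => ?_, ?_, ?_, ?_⟩
  · simpa only [Nat.reduceSub, pow_one] using
      (hasSum_mul_ramanujanSum N hN0 one_lt_two (a := fun n => ((Nat.choose (2 * n) n : ℂ))⁻¹)
        hasSum_pnat_inv_choose_sq).summable_and_eq_mul_tsum (by norm_num)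
  · exact (hasSum_mul_ramanujanSum N hN0 (m := 3) (by norm_num)
        (a := fun n => (-1 : ℂ) ^ (n - 1) * ((Nat.choose (2 * n) n : ℂ))⁻¹)
        hasSum_pnat_inv_choose_cube).summable_and_eq_mul_tsum (by norm_num)
  · exact (hasSum_mul_ramanujanSum N hN0 (m := 4) (by norm_num)
        (a := fun n => ((Nat.choose (2 * n) n : ℂ))⁻¹)
        hasSum_pnat_inv_choose_fourth).summable_and_eq_mul_tsum (by norm_num)
  · have h := LSeriesHasSum_iff_hasSum_pnat.1 (LSeriesHasSum_ramanujanSum N hN0 hs)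
    rw [inv_mul_eq_div] at h
    exact h.summable_and_eq_mul_tsum (riemannZeta_ne_zero_of_one_lt_re hs)
  · exact hasSum_pnat_inv_choose_sq.summable_and_eq_mul_tsum (by norm_num)
  · exact hasSum_pnat_inv_choose_cube.summable_and_eq_mul_tsum (by norm_num)
  · exact hasSum_pnat_inv_choose_fourth.summable_and_eq_mul_tsum (by norm_num)
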